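/- **Setting.** Let $G$ be a finite connected simple graph with a fixed planar embedding, given by the cyclic order of the edges around each vertex. Some (possibly all) vertices of $G$ are partitioned into non-empty clusters (a flat clustered graph), and $G[\alpha]$ denotes the subgraph induced by the vertices of cluster $\alpha$. For a face $f$ of $G$, let $B_f=(o_1,\dots,o_k)$ be the cyclic sequence of occurrences of vertices along the boundary of $f$ (a vertex may occur several times). A *con-edge* for $\alpha$ is an unordered pair of occurrences on the same boundary $B_f$ of two vertices of $\alpha$ that lie in different connected components of $G[\alpha]$. Two con-edges $e,e'$ *conflict* if both lie in the same face $f$ and their occurrences alternate in the cyclic order $B_f$. The *multigraph of the con-edges* has the con-edges as edges; its vertices belonging to $\alpha$ are the connected components of $G[\alpha]$. Let $A$ be this multigraph, or any multigraph obtained from it by a finite sequence of steps, each of which either removes a set of con-edges, or contracts (that is, deletes and identifies the end-vertices of) a set of con-edges none of which conflicts with a con-edge present at that time. We also write $A$ for its edge set. The *conflict graph* $K_A$ has vertex set $A$, with $e,e'$ adjacent if and only if they conflict. A *planar set of spanning trees* for $A$ is a set $S\subseteq A$ such that, for each cluster $\alpha$, the con-edges for $\alpha$ in $S$ form a tree spanning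 all vertices of $A$ belonging to $\alpha$, and no two con-edges in $S$ conflict. **Lemma.** Assume that no two distinct con-edges of $A$ for the same cluster belong to the same connected component of $K_A$. Let $e_\alpha,e_\beta\in A$ be con-edges that conflict, let $S$ be a planar set of spanning trees for $A$, and suppose that $e_\alpha\notin S$. Then $e_\beta\in S$. -/

import Mathlib

/-- The face permutation of a rotation system: traverse the dart `d`, then turn to the next dart
around the vertex that was reached. Its cycles are the faces. -/
def facePerm {V : Type*} {G : SimpleGraph V} (rot : Equiv.Perm G.Dart) : Equiv.Perm G.Dart :=
  ((SimpleGraph.Dart.symm_involutive (G := G)).toPerm _).trans rot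

/-- A planar embedding (on the sphere) of a connected finite simple graph `G`, given as an order of
the edges incident to each vertex. An edge incident to a vertex `v` is represented by the dart
leaving `v`, and `rot` sends a dart to the next dart around its origin. Planarity is the requirement
that the induced faces satisfy Euler's formula. -/
structure PlanarEmbedding {V : Type*} (G : SimpleGraph V) where
  connected : G.Connected
  rot : Equiv.Perm G.Dart
  rot_fst : ∀ d, (rot d).fst = d.fst
  rot_sameCycle : ∀ d d' : G.Dart, d.fst = d'.fst → rot.SameCycle d d'
  /-- Euler's formula `|V| + |F| = |E| + 2`. The faces are the cycles of `facePerm rot`,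
  except that the one-vertex graph, which has no darts, has one face. -/
  euler : Nat.card V + max 1 (Nat.card (Quotient (Equiv.Perm.SameCycle.setoid (facePerm rot)))) =
    Nat.card G.edgeSet + 2

/-- A connected flat clustered graph with a fixed planar embedding. Every vertex is in at most one
cluster; `clusterOf v = none` means that `v` is a child of the root of the inclusion tree. -/
structure EmbeddedFlatClusteredGraph (V ι : Type*) [Finite V] where
  graph : SimpleGraph V
  embedding : PlanarEmbedding graph
  clusterOf : V → Option ι
  cluster_nonempty : ∀ α, ∃ v, clusterOf v = some α

namespace EmbeddedFlatClusteredGraph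

variable {V ι : Type*} [Finite V] (C : EmbeddedFlatClusteredGraph V ι)

/-- The occurrences of vertices along the boundaries of the faces: the dart `d` stands for the
occurrence of the vertex `d.fst` at the moment when the boundary walk of the face containing `d`
is about to traverse `d`. -/
abbrev Occ : Type _ := C.graph.Dart

/-- The next occurrence along the boundary of the same face. -/
def next : Equiv.Perm C.Occ := facePerm C.embedding.rot

/-- The vertices in cluster `α`. -/
def cluster (α : ι) : Set V := {v | C.clusterOf v = some α}

/-- `e` is a con-edge for `α`: an unordered pair of occurrences, along the boundary of one face,
of two vertices of `α` lying in different connected components of `G[α]`. -/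
def IsConEdgeFor (α : ι) (e : Sym2 C.Occ) : Prop :=
  ∃ (a b : C.Occ) (ha : a.fst ∈ C.cluster α) (hb : b.fst ∈ C.cluster α),
    e = s(a, b) ∧ C.next.SameCycle a b ∧
      ¬ (C.graph.induce (C.cluster α)).Reachable ⟨a.fst, ha⟩ ⟨b.fst, hb⟩

/-- All con-edges. -/
def conEdges : Set (Sym2 C.Occ) := {e | ∃ α, C.IsConEdgeFor α e}

/-- The occurrences `a, b, c, d` are distinct and appear in this cyclic order along the boundary
of a face. -/
def CyclicOrder (a b c d : C.Occ) : Prop :=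
  ∃ i j k : ℕ, 0 < i ∧ i < j ∧ j < k ∧ k < Function.minimalPeriod C.next a ∧
    (C.next ^ i) a = b ∧ (C.next ^ j) a = c ∧ (C.next ^ k) a = d

/-- Two pairs of occurrences conflict (cross) if they alternate along the boundary of a face. -/
def Conflict (e e' : Sym2 C.Occ) : Prop :=
  ∃ a b c d : C.Occ, e = s(a, b) ∧ e' = s(c, d) ∧ C.CyclicOrder a c b d

variable {C} in
theorem CyclicOrder.rotate {a b c d : C.Occ} (h : C.CyclicOrder a b c d) :
    C.CyclicOrder b c d a := by
  obtain ⟨i, j, k, hi, hij, hjk, hk, rfl, rfl, rfl⟩ := h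
  have hp : ∀ m : ℕ, (C.next ^ m) a = C.next^[m] a := fun m => by
    rw [Equiv.Perm.iterate_eq_pow]
  have hper : Function.minimalPeriod C.next ((C.next ^ i) a)
      = Function.minimalPeriod C.next a := by
    rw [hp]
    exact Function.minimalPeriod_apply_iterate
      (Function.minimalPeriod_pos_iff_mem_periodicPts.1 (by omega)) i
  refine ⟨j - i, k - i, Function.minimalPeriod C.next a - i, by omega, by omega, by omega,
    by rw [hper]; omega, ?_, ?_, ?_⟩
  · rw [← Equiv.Perm.mul_apply, ← pow_add, Nat.sub_add_cancel (by omega)]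
  · rw [← Equiv.Perm.mul_apply, ← pow_add, Nat.sub_add_cancel (by omega)]
  · rw [← Equiv.Perm.mul_apply, ← pow_add, Nat.sub_add_cancel (by omega), hp]
    exact Function.iterate_minimalPeriod

variable {C} in
theorem CyclicOrder.fst_ne_snd {a b c d : C.Occ} (h : C.CyclicOrder a b c d) : a ≠ b := by
  obtain ⟨i, j, k, hi, hij, hjk, hk, rfl, -, -⟩ := h
  intro hab
  rw [← Equiv.Perm.iterate_eq_pow] at hab
  have := Function.IsPeriodicPt.minimalPeriod_le hi (show C.next^[i] a = a from hab.symm)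
  omega

theorem conflict_symm {e e' : Sym2 C.Occ} (h : C.Conflict e e') : C.Conflict e' e := by
  obtain ⟨a, b, c, d, rfl, rfl, h⟩ := h
  exact ⟨c, d, b, a, rfl, Sym2.eq_swap, h.rotate⟩

theorem conflict_irrefl (e : Sym2 C.Occ) : ¬ C.Conflict e e := by
  rintro ⟨a, b, c, d, rfl, h', h⟩
  have h1 := h.fst_ne_snd
  have h2 := h.rotate.fst_ne_snd
  have h3 := h.rotate.rotate.fst_ne_snd
  have h4 := h.rotate.rotate.rotate.fst_ne_snd
  rw [Sym2.eq_iff] at h'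
  rcases h' with ⟨h5, -⟩ | ⟨h5, -⟩
  · exact h1 h5
  · exact h4 h5.symm

/-- The conflict graph `K_A` of a set `A` of con-edges. -/
def conflictGraph (A : Set (Sym2 C.Occ)) : SimpleGraph A where
  Adj e e' := C.Conflict e e'
  symm := ⟨fun _ _ h => C.conflict_symm h⟩
  loopless := ⟨fun e => C.conflict_irrefl e⟩

/-- No two distinct con-edges of `A` for the same cluster are in one connected component
of `K_A`. -/
def OnePerComponent (A : Set (Sym2 C.Occ)) : Prop :=
  ∀ (α : ι) (e e' : A), C.IsConEdgeFor α e → C.IsConEdgeFor α e' →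
    (C.conflictGraph A).Reachable e e' → e = e'

/-- `IsInstance A R`: a multigraph with edge set `A`, obtained from the multigraph of all
con-edges by a sequence of removals of con-edges and of contractions of con-edges that cross no
con-edge present at that time; `R` is the set of the con-edges contracted so far. -/
inductive IsInstance : Set (Sym2 C.Occ) → Set (Sym2 C.Occ) → Prop
  | full : IsInstance C.conEdges ∅
  | remove (A R A' : Set (Sym2 C.Occ)) : IsInstance A R → IsInstance (A \ A') R
  | contract (A R A' : Set (Sym2 C.Occ)) : IsInstance A R → A' ⊆ A →
      (∀ e ∈ A', ∀ e' ∈ A, ¬ C.Conflict e e') → IsInstance (A \ A') (R ∪ A')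

/-- The graph on the vertices of `α` consisting of the edges of `G[α]` and of the pairs of
end-vertices of the contracted con-edges `R`. -/
def mergeGraph (R : Set (Sym2 C.Occ)) (α : ι) : SimpleGraph (C.cluster α) :=
  C.graph.induce (C.cluster α) ⊔
    SimpleGraph.fromRel fun u v => ∃ a b : C.Occ, s(a, b) ∈ R ∧ a.fst = u ∧ b.fst = v

/-- The vertices belonging to `α` of the multigraph of the con-edges: each connected component of
`G[α]` is one vertex, and the end-vertices of each contracted con-edge are identified. -/
abbrev Node (R : Set (Sym2 C.Occ)) (α : ι) : Type _ := (C.mergeGraph R α).ConnectedComponent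

/-- For a set `S` of con-edges, the multigraph `S[α]` whose edges are the con-edges for `α` in `S`,
on all the vertices belonging to `α`. -/
def clusterMultigraph (R S : Set (Sym2 C.Occ)) (α : ι) : Graph (C.Node R α) (Sym2 C.Occ) where
  vertexSet := Set.univ
  IsLink e x y := e ∈ S ∧ C.IsConEdgeFor α e ∧
    ∃ (a b : C.Occ) (ha : a.fst ∈ C.cluster α) (hb : b.fst ∈ C.cluster α), e = s(a, b) ∧
      x = (C.mergeGraph R α).connectedComponentMk ⟨a.fst, ha⟩ ∧
      y = (C.mergeGraph R α).connectedComponentMk ⟨b.fst, hb⟩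
  isLink_symm := by
    rintro e -
    refine ⟨?_⟩
    rintro x y ⟨hS, hc, a, b, ha, hb, he, hx, hy⟩
    exact ⟨hS, hc, b, a, hb, ha, he.trans Sym2.eq_swap, hy, hx⟩
  eq_or_eq_of_isLink_of_isLink := by
    rintro e x y v w ⟨-, -, a, b, ha, hb, rfl, rfl, rfl⟩ ⟨-, -, c, d, hc, hd, he, rfl, rfl⟩
    rcases Sym2.eq_iff.1 he with ⟨rfl, rfl⟩ | ⟨rfl, rfl⟩
    · exact Or.inl rfl
    · exact Or.inr rfl
  left_mem_of_isLink := fun _ _ _ _ => Set.mem_univ _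

/-- A multigraph is a tree if it has no loops and no parallel edges and is a tree as a simple
graph. -/
def IsMultigraphTree {X Y : Type*} (H : Graph X Y) : Prop :=
  H.Simple ∧ H.toSimpleGraph.IsTree

/-- A planar set `S` of spanning trees for the multigraph with edge set `A` and contracted
con-edges `R`. -/
structure IsPlanarSpanningTrees (A R S : Set (Sym2 C.Occ)) : Prop where
  subset : S ⊆ A
  tree : ∀ α, IsMultigraphTree (C.clusterMultigraph R S α)
  planar : ∀ e ∈ S, ∀ e' ∈ S, ¬ C.Conflict e e'

end EmbeddedFlatClusteredGraph

/-! This is a Jordan curve argument modulo 2. Suppose neither con-edge lies in `S`. Edges of `G[α]`,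
con-edges of `S` and contracted con-edges join the ends of `eα` (`reflTransGen_joined`,
`exists_isChain`); adding `eα` gives a closed chain of `α`. Since the first cohomology of the sphere
vanishes (`exists_potential`), this chain has a two-valued potential `ψ` that changes exactly where
the chain is crossed. Here `ψ d` belongs to the side of the dart `d`, just after the occurrence `d`
on the boundary walk.

The ends of `eβ` are also joined inside `β`. This connection never crosses the chain: members of `S`
do not cross one another, contracted con-edges cross nothing relevant, and a con-edge for `β` in `S`
that crosses `eα` would share the component of `eβ` and so equal it. Hence `ψ` agrees at the ends of
`eβ`. But `eβ` crosses `eα`, and no other con-edge of the chain, because one in `S` would share the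
component of `eα`. So `ψ` differs at these ends, a contradiction. -/

/-! ### Sums along the cycles of a permutation -/

open Finset in
theorem Equiv.Perm.sum_iterate_eq_sum_sameCycle {D M : Type*} [Fintype D] [AddCommMonoid M]
    (π : Equiv.Perm D) [DecidableRel π.SameCycle] (h : D → M) (r : D) :
    ∑ j ∈ range (Function.minimalPeriod π r), h (π^[j + 1] r) =
      ∑ d with π.SameCycle r d, h d := by
  classical
  have hmem : r ∈ Function.periodicPts π := π.injective.mem_periodicPts r
  have hpos := Function.minimalPeriod_pos_of_mem_periodicPts hmem
  refine sum_bij (fun j _ => π^[j + 1] r) ?_ ?_ ?_ (fun _ _ => rfl)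
  · intro j _
    simp only [mem_filter, mem_univ, true_and]
    exact ⟨(j + 1 : ℕ), by rw [zpow_natCast, ← Equiv.Perm.iterate_eq_pow]⟩
  · intro i hi j hj hij
    rw [Function.iterate_succ_apply', Function.iterate_succ_apply'] at hij
    exact Function.iterate_injOn_Iio_minimalPeriod (by simpa using hi) (by simpa using hj)
      (π.injective hij)
  · intro d hd
    simp only [mem_filter, mem_univ, true_and] at hd
    obtain ⟨i, -, hi⟩ := (Equiv.Perm.sameCycle_symm_apply_right.2 hd).exists_pow_eq'
    rw [← Equiv.Perm.iterate_eq_pow] at hi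
    refine ⟨i % Function.minimalPeriod π r, by simpa using Nat.mod_lt _ hpos, ?_⟩
    rw [Function.iterate_succ_apply', Function.iterate_mod_minimalPeriod_eq, hi]
    exact π.apply_symm_apply d

open Finset in
/-- A function whose sum over each cycle of `π` vanishes is a difference along `π`. -/
theorem Equiv.Perm.exists_sub_eq_of_sum_sameCycle_eq_zero {D M : Type*} [Fintype D]
    [AddCommGroup M] (π : Equiv.Perm D) [DecidableRel π.SameCycle] (h : D → M)
    (hh : ∀ r, ∑ d with π.SameCycle r d, h d = 0) :
    ∃ χ : D → M, ∀ d, χ (π d) = χ d + h (π d) := by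
  classical
  let rep : D → D := fun d => (Quotient.mk (Equiv.Perm.SameCycle.setoid π) d).out
  have hrep : ∀ d, π.SameCycle (rep d) d := fun d =>
    Quotient.exact (Quotient.out_eq (Quotient.mk (Equiv.Perm.SameCycle.setoid π) d))
  have hrep' : ∀ d, rep (π d) = rep d := fun d => by
    have : Quotient.mk (Equiv.Perm.SameCycle.setoid π) (π d) = Quotient.mk _ d :=
      Quotient.sound (Equiv.Perm.sameCycle_apply_left.2 (Equiv.Perm.SameCycle.refl π d))
    simp only [rep, this]
  have hex : ∀ d, ∃ i : ℕ, π^[i] (rep d) = d := fun d => by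
    obtain ⟨i, -, hi⟩ := (hrep d).exists_pow_eq'
    exact ⟨i, by rw [Equiv.Perm.iterate_eq_pow, hi]⟩
  choose ind hind using hex
  -- Each step is charged `h` at the dart it enters, hence the shift `j + 1`. Vanishing cycle sums
  -- make `F` periodic, so its value depends only on the dart reached.
  let F : D → ℕ → M := fun r i => ∑ j ∈ range i, h (π^[j + 1] r)
  have hper : ∀ r, Function.Periodic (F r) (Function.minimalPeriod π r) := by
    intro r i
    have h1 : F r (Function.minimalPeriod π r + i) = F r i := by
      simp only [F, sum_range_add, π.sum_iterate_eq_sum_sameCycle, hh, zero_add]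
      refine sum_congr rfl fun j _ => ?_
      rw [show Function.minimalPeriod π r + j + 1 = j + 1 + Function.minimalPeriod π r by ring,
        Function.iterate_add_apply, Function.iterate_minimalPeriod]
    rw [add_comm, h1]
  have hwd : ∀ r i i', π^[i] r = π^[i'] r → F r i = F r i' := by
    intro r i i' hi
    have hmem : r ∈ Function.periodicPts π := π.injective.mem_periodicPts r
    have hpos := Function.minimalPeriod_pos_of_mem_periodicPts hmem
    rw [← (hper r).map_mod_nat i, ← (hper r).map_mod_nat i']
    congr 1
    refine Function.iterate_injOn_Iio_minimalPeriod (f := π) (x := r) (Nat.mod_lt _ hpos)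
      (Nat.mod_lt _ hpos) ?_
    simp only [Function.iterate_mod_minimalPeriod_eq, hi]
  refine ⟨fun d => F (rep d) (ind d), fun d => ?_⟩
  have h1 : F (rep (π d)) (ind (π d)) = F (rep d) (ind d + 1) := by
    rw [hrep']
    apply hwd
    rw [Function.iterate_succ_apply', hind d, ← hrep' d, hind (π d)]
  show F (rep (π d)) (ind (π d)) = _
  rw [h1]
  simp only [F, sum_range_succ, Function.iterate_succ_apply', hind]

/-! ### Homology and cohomology of the sphere modulo 2 -/

namespace PlanarEmbedding

open Finset Matrix
open scoped Classical

variable {V : Type*} {G : SimpleGraph V}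

theorem facePerm_symm (rot : Equiv.Perm G.Dart) (d : G.Dart) : facePerm rot d.symm = rot d := by
  simp [facePerm]

/-- The faces of a graph with a rotation system. -/
abbrev Face (rot : Equiv.Perm G.Dart) : Type _ :=
  Quotient (Equiv.Perm.SameCycle.setoid (facePerm rot))

/-- The face whose boundary walk contains a dart. -/
abbrev face (rot : Equiv.Perm G.Dart) (d : G.Dart) : Face rot := Quotient.mk _ d

theorem face_facePerm (rot : Equiv.Perm G.Dart) (d : G.Dart) :
    face rot (facePerm rot d) = face rot d :=
  Quotient.sound (Equiv.Perm.sameCycle_apply_left.2 (Equiv.Perm.SameCycle.refl _ d))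

theorem face_symm (rot : Equiv.Perm G.Dart) (d : G.Dart) :
    face rot d.symm = face rot (rot d) := by
  rw [← facePerm_symm, face_facePerm]

/-- The edge of a dart, as an element of the edge set. -/
abbrev dartEdge (d : G.Dart) : G.edgeSet := ⟨d.edge, d.edge_mem⟩

variable [Fintype V]

theorem sum_dartEdge_eq (f : G.Dart → ZMod 2) (d : G.Dart) :
    ∑ d' with dartEdge d' = dartEdge d, f d' = f d + f d.symm := by
  have : ({d' | dartEdge d' = dartEdge d} : Finset G.Dart) = {d, d.symm} := by
    ext d'
    simp [dartEdge, SimpleGraph.dart_edge_eq_iff]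
  rw [this, sum_pair d.symm_ne.symm]

/-- The vertex-edge incidence matrix modulo 2. -/
noncomputable def incMatrix (G : SimpleGraph V) : Matrix V G.edgeSet (ZMod 2) :=
  fun v e => ∑ d : G.Dart with dartEdge d = e, if d.fst = v then 1 else 0

/-- The edge-face incidence matrix modulo 2. -/
noncomputable def faceMatrix (rot : Equiv.Perm G.Dart) :
    Matrix G.edgeSet (Face rot) (ZMod 2) :=
  fun e f => ∑ d : G.Dart with dartEdge d = e, if face rot d = f then 1 else 0

theorem incMatrix_mulVec (z : G.edgeSet → ZMod 2) (v : V) :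
    (incMatrix G *ᵥ z) v = ∑ d : G.Dart with d.fst = v, z (dartEdge d) := by
  simp only [Matrix.mulVec, dotProduct, incMatrix, sum_filter, sum_mul]
  rw [sum_comm]
  refine sum_congr rfl fun d _ => ?_
  rw [sum_eq_single (dartEdge d)] <;> simp +contextual [eq_comm]

theorem incMatrix_transpose_mulVec (p : V → ZMod 2) (d : G.Dart) :
    ((incMatrix G)ᵀ *ᵥ p) (dartEdge d) = p d.fst + p d.snd := by
  have : ((incMatrix G)ᵀ *ᵥ p) (dartEdge d) =
      ∑ d' : G.Dart with dartEdge d' = dartEdge d, p d'.fst := by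
    simp only [Matrix.mulVec, dotProduct, incMatrix, transpose_apply, sum_mul]
    rw [sum_comm]
    refine sum_congr rfl fun d' _ => ?_
    simp
  rw [this, sum_dartEdge_eq fun d => p d.fst]
  rfl

theorem faceMatrix_mulVec (rot : Equiv.Perm G.Dart) (φ : Face rot → ZMod 2) (d : G.Dart) :
    (faceMatrix rot *ᵥ φ) (dartEdge d) = φ (face rot d) + φ (face rot d.symm) := by
  have : (faceMatrix rot *ᵥ φ) (dartEdge d) =
      ∑ d' : G.Dart with dartEdge d' = dartEdge d, φ (face rot d') := by
    simp only [Matrix.mulVec, dotProduct, faceMatrix, sum_mul]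
    rw [sum_comm]
    refine sum_congr rfl fun d' _ => ?_
    simp
  rw [this, sum_dartEdge_eq fun d => φ (face rot d)]

theorem sum_rot (E : PlanarEmbedding G) (f : G.Dart → ZMod 2) (v : V) :
    ∑ d : G.Dart with d.fst = v, f (E.rot d) = ∑ d : G.Dart with d.fst = v, f d :=
  sum_equiv E.rot (by simp [E.rot_fst]) (fun _ _ => rfl)

theorem zmod_two_eq_of_add_eq_zero {a b : ZMod 2} (h : a + b = 0) : a = b := by
  rw [← sub_eq_zero, CharTwo.sub_eq_add, h]

/-- Over `ZMod 2` the only constant functions are 0 and 1, so the kernel is spanned by the function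
1 if that lies in it, and is zero otherwise. -/
theorem finrank_ker_le_one_of_forall_eq {X : Type*} [Fintype X] {Y : Type*}
    (M : Matrix Y X (ZMod 2)) (h : ∀ p, M *ᵥ p = 0 → ∀ x y, p x = p y) :
    Module.finrank (ZMod 2) (LinearMap.ker M.mulVecLin) ≤ 1 := by
  refine finrank_le_one_iff.2 ?_
  by_cases h1 : M *ᵥ (fun _ => 1) = 0
  · refine ⟨⟨fun _ => 1, h1⟩, fun w => ?_⟩
    rcases isEmpty_or_nonempty X with hX | ⟨⟨x⟩⟩
    · exact ⟨0, Subtype.ext (funext fun x => hX.elim x)⟩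
    · refine ⟨w.1 x, Subtype.ext (funext fun y => ?_)⟩
      simpa using h w.1 w.2 x y
  · refine ⟨0, fun w => ⟨0, ?_⟩⟩
    refine Subtype.ext (funext fun y => ?_)
    by_contra hy
    apply h1
    have h2 : w.1 y = 1 := by
      have : ∀ a : ZMod 2, ¬ (0 = a) → a = 1 := by decide
      exact this _ (by simpa using hy)
    have h3 : w.1 = fun _ => 1 := funext fun x => (h w.1 w.2 x y).trans h2
    rw [← h3]
    exact w.2

/-- Face boundaries are cycles, and a dimension count gives equality: connectedness of the graph and
of its dual bounds the ranks below by `|V| - 1` and `|F| - 1`, and Euler's formula makes these add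
up to `|E|`. -/
theorem range_faceMatrix (E : PlanarEmbedding G) [Nonempty G.Dart] :
    LinearMap.range (faceMatrix E.rot).mulVecLin = LinearMap.ker (incMatrix G).mulVecLin := by
  refine Submodule.eq_of_le_of_finrank_le ?_ ?_
  · rintro _ ⟨φ, rfl⟩
    refine LinearMap.mem_ker.2 (funext fun v => ?_)
    simp only [Matrix.mulVecLin_apply, incMatrix_mulVec, faceMatrix_mulVec, face_symm,
      sum_add_distrib, E.sum_rot fun d => φ (face E.rot d)]
    exact CharTwo.add_self_eq_zero _
  · have hV : Module.finrank (ZMod 2) (LinearMap.ker (incMatrix G)ᵀ.mulVecLin) ≤ 1 := by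
      refine finrank_ker_le_one_of_forall_eq _ fun p hp x y => ?_
      have hr := E.connected.preconnected x y
      rw [SimpleGraph.reachable_iff_reflTransGen] at hr
      induction hr with
      | refl => rfl
      | @tail y z _ hyz ih =>
        rw [ih]
        have := congrFun hp (dartEdge ⟨(y, z), hyz⟩)
        rw [incMatrix_transpose_mulVec] at this
        exact zmod_two_eq_of_add_eq_zero this
    -- Connectedness of the dual: a kernel element agrees on the two sides of each edge, hence on
    -- all faces around a vertex, hence along any walk in `G`.
    have hF : Module.finrank (ZMod 2) (LinearMap.ker (faceMatrix E.rot).mulVecLin) ≤ 1 := by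
      refine finrank_ker_le_one_of_forall_eq _ fun φ hφ f₁ f₂ => ?_
      have hs : ∀ d, φ (face E.rot d) = φ (face E.rot d.symm) := fun d => by
        have := congrFun hφ (dartEdge d)
        rw [faceMatrix_mulVec] at this
        exact zmod_two_eq_of_add_eq_zero this
      have hpow : ∀ (i : ℕ) d, φ (face E.rot ((E.rot ^ i) d)) = φ (face E.rot d) := by
        intro i
        induction i with
        | zero => simp
        | succ i ih =>
          intro d
          rw [pow_succ', Equiv.Perm.mul_apply, ← face_symm, ← hs, ih]
      have hv : ∀ d d' : G.Dart, d.fst = d'.fst → φ (face E.rot d) = φ (face E.rot d') := by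
        intro d d' h
        obtain ⟨i, -, rfl⟩ := (E.rot_sameCycle d d' h).exists_pow_eq'
        exact (hpow i d).symm
      have hall : ∀ x y, G.Reachable x y → ∀ d d' : G.Dart, d.fst = x → d'.fst = y →
          φ (face E.rot d) = φ (face E.rot d') := by
        intro x y hr d d' hd hd'
        rw [SimpleGraph.reachable_iff_reflTransGen] at hr
        induction hr generalizing d' with
        | refl => exact hv d d' (hd.trans hd'.symm)
        | @tail y z _ hyz ih =>
          rw [ih ⟨(y, z), hyz⟩ rfl, hs]
          exact hv _ _ hd'.symm
      induction f₁ using Quotient.inductionOn with | _ d =>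
      induction f₂ using Quotient.inductionOn with | _ d' =>
      exact hall _ _ (E.connected.preconnected _ _) d d' rfl rfl
    have r1 := LinearMap.finrank_range_add_finrank_ker (incMatrix G).mulVecLin
    have r2 := LinearMap.finrank_range_add_finrank_ker (incMatrix G)ᵀ.mulVecLin
    have r3 := LinearMap.finrank_range_add_finrank_ker (faceMatrix E.rot).mulVecLin
    have r4 : Module.finrank (ZMod 2) (LinearMap.range (incMatrix G)ᵀ.mulVecLin) =
        Module.finrank (ZMod 2) (LinearMap.range (incMatrix G).mulVecLin) :=
      Matrix.rank_transpose (incMatrix G)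
    have e := E.euler
    have hne : Nonempty (Face E.rot) := ‹Nonempty G.Dart›.map (face E.rot)
    have hpos : 0 < Nat.card (Face E.rot) := Nat.card_pos
    simp only [Module.finrank_fintype_fun_eq_card, ← Nat.card_eq_fintype_card] at r1 r2 r3
    change Nat.card V + max 1 (Nat.card (Face E.rot)) = _ at e
    rw [max_eq_right hpos] at e
    omega

/-- The first cohomology modulo 2 of the sphere vanishes: on the graph of all darts, where each dart
is joined to its reverse and to its successor on its face, each cocycle `(g, h)` is a
coboundary. -/
theorem exists_potential (E : PlanarEmbedding G) (g h : G.Dart → ZMod 2)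
    (hg : ∀ d, g d.symm = g d)
    (hh : ∀ r, ∑ d with (facePerm E.rot).SameCycle r d, h d = 0)
    (hv : ∀ v, ∑ d : G.Dart with d.fst = v, (g d + h d) = 0) :
    ∃ ψ : G.Dart → ZMod 2, (∀ d, ψ d + ψ d.symm = g d) ∧
      ∀ d, ψ (facePerm E.rot d) = ψ d + h (facePerm E.rot d) := by
  rcases isEmpty_or_nonempty G.Dart with hD | hD
  · exact ⟨fun _ => 0, fun d => hD.elim d, fun d => hD.elim d⟩
  obtain ⟨χ, hχ⟩ := (facePerm E.rot).exists_sub_eq_of_sum_sameCycle_eq_zero h hh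
  -- `χ` solves the face equations only; `z` is its error in the edge equations. The vertex
  -- condition makes `z` a cycle, hence a sum of face boundaries.
  have hz : ∃ z : G.edgeSet → ZMod 2, ∀ d, z (dartEdge d) = g d + χ d + χ d.symm := by
    have : ∀ e : G.edgeSet, ∃ d : G.Dart, dartEdge d = e := by
      rintro ⟨⟨v, w⟩, he⟩
      exact ⟨⟨(v, w), he⟩, rfl⟩
    choose dart hdart using this
    refine ⟨fun e => g (dart e) + χ (dart e) + χ (dart e).symm, fun d => ?_⟩
    rcases (SimpleGraph.dart_edge_eq_iff _ _).1
      (congrArg Subtype.val (hdart (dartEdge d))) with h | h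
    · simp only [h]
    · simp only [h, hg, SimpleGraph.Dart.symm_symm]
      ring
  obtain ⟨z, hz⟩ := hz
  have hzk : z ∈ LinearMap.ker (incMatrix G).mulVecLin := by
    refine LinearMap.mem_ker.2 (funext fun v => ?_)
    have h1 : ∀ d, χ d.symm = χ (E.rot d) + h (E.rot d) := fun d => by
      have := hχ d.symm
      rw [facePerm_symm] at this
      rw [this, add_assoc, CharTwo.add_self_eq_zero, add_zero]
    have h2 := hv v
    rw [sum_add_distrib] at h2
    simp only [Matrix.mulVecLin_apply, incMatrix_mulVec, hz, h1, sum_add_distrib,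
      E.sum_rot, Pi.zero_apply]
    linear_combination h2 + CharTwo.add_self_eq_zero (∑ d : G.Dart with d.fst = v, χ d)
  rw [← range_faceMatrix E] at hzk
  obtain ⟨φ, rfl⟩ := hzk
  -- A correction that is constant on each face repairs the edge equations and keeps the face
  -- equations.
  refine ⟨fun d => χ d + φ (face E.rot d), fun d => ?_, fun d => ?_⟩
  · have := hz d
    rw [Matrix.mulVecLin_apply, faceMatrix_mulVec] at this
    linear_combination this + CharTwo.add_self_eq_zero (χ d) + CharTwo.add_self_eq_zero (χ d.symm)
  · simp only [hχ, face_facePerm]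
    ring

end PlanarEmbedding

/-! ### Connections inside a cluster -/

namespace EmbeddedFlatClusteredGraph

open Finset
open scoped Classical

variable {V ι : Type*}

section Clusters

variable [Finite V] {C : EmbeddedFlatClusteredGraph V ι}

theorem eq_of_mem_cluster {α β : ι} {v : V} (h : v ∈ C.cluster α) (h' : v ∈ C.cluster β) :
    α = β := by
  have h1 : C.clusterOf v = some α := h
  have h2 : C.clusterOf v = some β := h'
  rw [h1] at h2
  exact Option.some_injective _ h2

theorem IsConEdgeFor.exists_eq {α : ι} {e : Sym2 C.Occ} (h : C.IsConEdgeFor α e) :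
    ∃ a b : C.Occ, e = s(a, b) ∧ a.fst ∈ C.cluster α ∧ b.fst ∈ C.cluster α ∧
      C.next.SameCycle a b ∧ a ≠ b := by
  obtain ⟨a, b, ha, hb, rfl, hs, hr⟩ := h
  refine ⟨a, b, rfl, ha, hb, hs, ?_⟩
  rintro rfl
  exact hr (SimpleGraph.Reachable.refl _)

theorem IsConEdgeFor.mem_cluster {α : ι} {e : Sym2 C.Occ} (h : C.IsConEdgeFor α e) {d : C.Occ}
    (hd : d ∈ e) : d.fst ∈ C.cluster α := by
  obtain ⟨a, b, rfl, ha, hb, -, -⟩ := h.exists_eq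
  rcases Sym2.mem_iff.1 hd with rfl | rfl <;> assumption

theorem IsInstance.subset_conEdges {A R : Set (Sym2 C.Occ)} (h : C.IsInstance A R) :
    A ⊆ C.conEdges ∧ R ⊆ C.conEdges := by
  induction h with
  | full => exact ⟨subset_rfl, Set.empty_subset _⟩
  | remove A R A' _ ih => exact ⟨Set.sdiff_subset.trans ih.1, ih.2⟩
  | contract A R A' _ hA' _ ih =>
    exact ⟨Set.sdiff_subset.trans ih.1, Set.union_subset ih.2 (hA'.trans ih.1)⟩

/-- Contraction requires the absence of conflicts with all con-edges then present, and whatever is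
present or contracted later is among these. -/
theorem IsInstance.not_conflict {A R : Set (Sym2 C.Occ)} (h : C.IsInstance A R) :
    ∀ e ∈ R, ∀ e' ∈ A ∪ R, ¬ C.Conflict e e' := by
  induction h with
  | full => simp
  | remove A R A' _ ih =>
    exact fun e he e' he' => ih e he e' (Set.union_subset_union_left R Set.sdiff_subset he')
  | contract A R A' _ hA' hc ih =>
    rintro e he e' he'
    have h' : e' ∈ A ∪ R := by
      rcases he' with h | h | h
      exacts [Or.inl h.1, Or.inr h, Or.inl (hA' h)]
    rcases he with he | he
    · exact ih e he e' h'
    · rcases h' with h' | h'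
      · exact hc e he e' h'
      · exact fun h => ih e' h' e (Or.inl (hA' he)) (C.conflict_symm h)

variable (C) in
/-- Two vertices of `α` are joined by an edge of `G[α]` or by a con-edge for `α` in `K`. -/
def Joined (K : Set (Sym2 C.Occ)) (α : ι) (u v : V) : Prop :=
  u ∈ C.cluster α ∧ v ∈ C.cluster α ∧ (C.graph.Adj u v ∨
    ∃ a b : C.Occ, s(a, b) ∈ K ∧ C.IsConEdgeFor α s(a, b) ∧ a.fst = u ∧ b.fst = v)

theorem joined_of_mem {K : Set (Sym2 C.Occ)} (hK : K ⊆ C.conEdges) {α : ι} {a b : C.Occ}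
    (hab : s(a, b) ∈ K) (ha : a.fst ∈ C.cluster α) (hb : b.fst ∈ C.cluster α) :
    C.Joined K α a.fst b.fst := by
  obtain ⟨α', hα'⟩ := hK hab
  obtain rfl := eq_of_mem_cluster ha (hα'.mem_cluster (Sym2.mem_mk_left a b))
  exact ⟨ha, hb, Or.inr ⟨a, b, hab, hα', rfl, rfl⟩⟩

theorem reflTransGen_joined_of_reachable {K R : Set (Sym2 C.Occ)} (hK : K ⊆ C.conEdges)
    (hR : R ⊆ K) {α : ι} {u v : C.cluster α} (h : (C.mergeGraph R α).Reachable u v) :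
    Relation.ReflTransGen (C.Joined K α) u v := by
  rw [SimpleGraph.reachable_iff_reflTransGen] at h
  induction h with
  | refl => exact .refl
  | @tail v w _ hvw ih =>
    refine ih.tail ?_
    rcases hvw with hvw | ⟨-, ⟨a, b, hab, ha, hb⟩ | ⟨a, b, hab, ha, hb⟩⟩
    · exact ⟨v.2, w.2, Or.inl hvw⟩
    · have := joined_of_mem hK (hR hab) (ha ▸ v.2) (hb ▸ w.2)
      rwa [ha, hb] at this
    · rw [Sym2.eq_swap] at hab
      have := joined_of_mem hK (hR hab) (hb ▸ v.2) (ha ▸ w.2)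
      rwa [ha, hb] at this

/-- A path in the spanning tree lifts to `G`: consecutive tree edges may meet one node at different
vertices, which `R` and `G[α]` connect. -/
theorem reflTransGen_joined {S R : Set (Sym2 C.Occ)} (hK : S ∪ R ⊆ C.conEdges) {α : ι}
    (hT : IsMultigraphTree (C.clusterMultigraph R S α)) {u v : V} (hu : u ∈ C.cluster α)
    (hv : v ∈ C.cluster α) : Relation.ReflTransGen (C.Joined (S ∪ R) α) u v := by
  have key : ∀ X Y, (C.clusterMultigraph R S α).toSimpleGraph.Reachable X Y →
      ∀ u v : C.cluster α, (C.mergeGraph R α).connectedComponentMk u = X.1 →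
        (C.mergeGraph R α).connectedComponentMk v = Y.1 →
        Relation.ReflTransGen (C.Joined (S ∪ R) α) u v := by
    intro X Y hXY
    rw [SimpleGraph.reachable_iff_reflTransGen] at hXY
    induction hXY with
    | refl =>
      intro u v hu hv
      exact reflTransGen_joined_of_reachable hK Set.subset_union_right
        (SimpleGraph.ConnectedComponent.exact (hu.trans hv.symm))
    | tail _ hYZ ih =>
      intro u v hu hv
      obtain ⟨-, e, he, -, a, b, ha, hb, rfl, hY, hZ⟩ := hYZ
      refine ((ih u ⟨a.fst, ha⟩ hu hY.symm).tail
        (joined_of_mem hK (Or.inl he) ha hb)).trans ?_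
      exact reflTransGen_joined_of_reachable hK Set.subset_union_right
        (u := ⟨b.fst, hb⟩) (SimpleGraph.ConnectedComponent.exact (hZ.symm.trans hv.symm))
  exact key ⟨_, Set.mem_univ _⟩ ⟨_, Set.mem_univ _⟩ (hT.2.1.preconnected _ _) ⟨u, hu⟩ ⟨v, hv⟩
    rfl rfl

end Clusters

/-! ### Chains modulo 2 of edges and con-edges -/

variable [Fintype V] {C : EmbeddedFlatClusteredGraph V ι}

/-- The number modulo 2 of con-edges in the chain `k` that end at the occurrence `d`. -/
noncomputable def endCount (k : Sym2 C.Occ → ZMod 2) (d : C.Occ) : ZMod 2 :=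
  ∑ e, k e * if d ∈ e then 1 else 0

theorem endCount_add (k k' : Sym2 C.Occ → ZMod 2) (d : C.Occ) :
    endCount (k + k') d = endCount k d + endCount k' d := by
  simp only [endCount, Pi.add_apply, add_mul, sum_add_distrib]

theorem ite_mem_mk {a b : C.Occ} (hab : a ≠ b) (d : C.Occ) :
    (if d ∈ s(a, b) then (1 : ZMod 2) else 0) =
      (if d = a then 1 else 0) + if d = b then 1 else 0 := by
  by_cases h : d = a
  · subst h
    simp [hab]
  · simp [h]

theorem endCount_single {a b : C.Occ} (hab : a ≠ b) (d : C.Occ) :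
    endCount (Pi.single s(a, b) 1) d = (if d = a then 1 else 0) + if d = b then 1 else 0 := by
  rw [← ite_mem_mk hab, endCount, sum_eq_single s(a, b)] <;> simp +contextual

/-- `g` and `k` are a chain modulo 2 of edges with both ends in `α` and of con-edges for `α` in `K`,
with boundary `u + v`. -/
structure IsChain (K : Set (Sym2 C.Occ)) (α : ι) (u v : V) (g : C.Occ → ZMod 2)
    (k : Sym2 C.Occ → ZMod 2) : Prop where
  symm : ∀ d, g d.symm = g d
  mem_cluster : ∀ d, g d ≠ 0 → d.fst ∈ C.cluster α
  conEdge : ∀ e, k e ≠ 0 → e ∈ K ∧ C.IsConEdgeFor α e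
  boundary : ∀ w, ∑ d : C.Occ with d.fst = w, (g d + endCount k d) =
    (if u = w then 1 else 0) + if v = w then 1 else 0

theorem IsChain.trans {K : Set (Sym2 C.Occ)} {α : ι} {u v w : V} {g g' : C.Occ → ZMod 2}
    {k k' : Sym2 C.Occ → ZMod 2} (h : IsChain K α u v g k) (h' : IsChain K α v w g' k') :
    IsChain K α u w (g + g') (k + k') where
  symm d := by simp [h.symm, h'.symm]
  mem_cluster d hd := by
    by_cases h0 : g d = 0
    · exact h'.mem_cluster d (by simpa [h0] using hd)
    · exact h.mem_cluster d h0
  conEdge e he := by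
    by_cases h0 : k e = 0
    · exact h'.conEdge e (by simpa [h0] using he)
    · exact h.conEdge e h0
  boundary x := by
    have h1 := h.boundary x
    have h2 := h'.boundary x
    rw [sum_add_distrib] at h1 h2
    simp only [endCount_add, Pi.add_apply, sum_add_distrib]
    linear_combination h1 + h2 + CharTwo.add_self_eq_zero (if v = x then (1 : ZMod 2) else 0)

theorem isChain_conEdge {K : Set (Sym2 C.Occ)} {α : ι} {a b : C.Occ} (hab : s(a, b) ∈ K)
    (h : C.IsConEdgeFor α s(a, b)) :
    IsChain K α a.fst b.fst (fun _ => 0) (Pi.single s(a, b) 1) where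
  symm _ := rfl
  mem_cluster _ h := absurd rfl h
  conEdge e he := by
    obtain rfl : e = s(a, b) := by
      by_contra h0
      exact he (by simp [h0])
    exact ⟨hab, h⟩
  boundary w := by
    have hne : a ≠ b := by
      obtain ⟨a', b', he, -, -, -, hne⟩ := h.exists_eq
      rcases Sym2.eq_iff.1 he with ⟨rfl, rfl⟩ | ⟨rfl, rfl⟩
      exacts [hne, hne.symm]
    simp [endCount_single hne, sum_add_distrib, sum_ite_eq']

theorem isChain_edge (K : Set (Sym2 C.Occ)) {α : ι} {u v : V} (hu : u ∈ C.cluster α)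
    (hv : v ∈ C.cluster α) (huv : C.graph.Adj u v) :
    IsChain K α u v (fun d => if d.edge = s(u, v) then 1 else 0) 0 where
  symm d := by simp
  mem_cluster d hd := by
    have h1 : d.edge = s(u, v) := by
      by_contra h0
      exact hd (by simp [h0])
    rcases Sym2.eq_iff.1 h1 with ⟨h2, -⟩ | ⟨h2, -⟩
    · exact h2 ▸ hu
    · exact h2 ▸ hv
  conEdge e he := absurd rfl he
  boundary w := by
    have h1 : ∀ d : C.Occ, (if d.edge = s(u, v) then (1 : ZMod 2) else 0) =
        (if d = ⟨(u, v), huv⟩ then 1 else 0) + if d = ⟨(v, u), huv.symm⟩ then 1 else 0 := by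
      intro d
      rw [← ite_mem_mk]
      · congr 1
        rw [Sym2.mem_iff]
        exact propext (SimpleGraph.dart_edge_eq_iff d ⟨(u, v), huv⟩)
      · intro h
        exact huv.ne (congrArg (fun d : C.Occ => d.fst) h)
    simp [h1, endCount, sum_add_distrib, sum_ite_eq']

theorem exists_isChain {K : Set (Sym2 C.Occ)} {α : ι} {u v : V}
    (h : Relation.ReflTransGen (C.Joined K α) u v) : ∃ g k, IsChain K α u v g k := by
  induction h with
  | refl =>
    exact ⟨0, 0, fun _ => rfl, fun _ h => absurd rfl h, fun _ h => absurd rfl h, fun w => by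
      simp [endCount, CharTwo.add_self_eq_zero]⟩
  | tail _ hvw ih =>
    obtain ⟨g, k, hgk⟩ := ih
    obtain ⟨hv, hw, hvw | ⟨a, b, hK, hab, rfl, rfl⟩⟩ := hvw
    · exact ⟨_, _, hgk.trans (isChain_edge K hv hw hvw)⟩
    · exact ⟨_, _, hgk.trans (isChain_conEdge hK hab)⟩

/-- Both ends of a con-edge lie on the same face, so they cancel. -/
theorem IsChain.sum_face {K : Set (Sym2 C.Occ)} {α : ι} {u v : V} {g : C.Occ → ZMod 2}
    {k : Sym2 C.Occ → ZMod 2} (h : IsChain K α u v g k) (r : C.Occ) :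
    ∑ d with C.next.SameCycle r d, endCount k d = 0 := by
  simp only [endCount]
  rw [sum_comm]
  refine sum_eq_zero fun e _ => ?_
  by_cases hk : k e = 0
  · simp [hk]
  obtain ⟨a, b, rfl, -, -, hs, hab⟩ := (h.conEdge e hk).2.exists_eq
  have hiff : C.next.SameCycle r a ↔ C.next.SameCycle r b :=
    ⟨fun h => h.trans hs, fun h => h.trans hs.symm⟩
  rw [← mul_sum]
  simp only [ite_mem_mk hab, sum_add_distrib, sum_ite_eq', mem_filter, mem_univ, true_and, hiff,
    CharTwo.add_self_eq_zero, mul_zero]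

/-! ### Crossings and parity on a face boundary -/

/-- The number modulo 2 of ends of `e` among the `m` occurrences that follow `x`. -/
noncomputable def arcCount (x : C.Occ) (m : ℕ) (e : Sym2 C.Occ) : ZMod 2 :=
  ∑ j ∈ range m, if C.next^[j + 1] x ∈ e then 1 else 0

theorem potential_iterate {k : Sym2 C.Occ → ZMod 2} {ψ : C.Occ → ZMod 2}
    (hψ : ∀ d, ψ (C.next d) = ψ d + endCount k (C.next d)) (x : C.Occ) (m : ℕ) :
    ψ (C.next^[m] x) = ψ x + ∑ e, k e * arcCount x m e := by
  simp only [arcCount, mul_sum]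
  rw [sum_comm]
  induction m with
  | zero => simp
  | succ m ih =>
    rw [sum_range_succ, Function.iterate_succ_apply', hψ, ih, add_assoc]
    rfl

theorem sum_iterate_eq {x : C.Occ} {i m : ℕ} (hi : 0 < i)
    (hin : i < Function.minimalPeriod C.next x) (hm : m < Function.minimalPeriod C.next x) :
    (∑ j ∈ range m, if C.next^[j + 1] x = C.next^[i] x then (1 : ZMod 2) else 0) =
      if i ≤ m then 1 else 0 := by
  have h : ∀ j ∈ range m, (if C.next^[j + 1] x = C.next^[i] x then (1 : ZMod 2) else 0) =
      if j = i - 1 then 1 else 0 := by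
    intro j hj
    have hj := mem_range.1 hj
    congr 1
    refine propext ⟨fun h => ?_, fun h => by rw [h, Nat.sub_add_cancel hi]⟩
    have := Function.iterate_injOn_Iio_minimalPeriod (f := C.next) (x := x)
      (show j + 1 < _ by omega) hin h
    omega
  rw [sum_congr rfl h, sum_ite_eq']
  congr 1
  rw [mem_range]
  exact propext (by omega)

theorem arcCount_mk {x : C.Occ} {i l m : ℕ} (hi : 0 < i)
    (hin : i < Function.minimalPeriod C.next x) (hl : 0 < l)
    (hln : l < Function.minimalPeriod C.next x) (hil : i ≠ l)
    (hm : m < Function.minimalPeriod C.next x) :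
    arcCount x m s(C.next^[i] x, C.next^[l] x) =
      (if i ≤ m then 1 else 0) + if l ≤ m then 1 else 0 := by
  have hne : C.next^[i] x ≠ C.next^[l] x := fun h =>
    hil (Function.iterate_injOn_Iio_minimalPeriod hin hln h)
  simp only [arcCount, ite_mem_mk hne, sum_add_distrib]
  rw [sum_iterate_eq hi hin hm, sum_iterate_eq hl hln hm]

theorem exists_iterate_eq {x p : C.Occ} (h : C.next.SameCycle x p) :
    ∃ i < Function.minimalPeriod C.next x, C.next^[i] x = p := by
  obtain ⟨i, -, hi⟩ := h.exists_pow_eq'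
  refine ⟨i % Function.minimalPeriod C.next x, Nat.mod_lt _
    (Function.minimalPeriod_pos_of_mem_periodicPts (C.next.injective.mem_periodicPts x)), ?_⟩
  rw [Function.iterate_mod_minimalPeriod_eq, Equiv.Perm.iterate_eq_pow, hi]

/-- An odd count means that exactly one end of `e` lies on the arc; as `e` avoids both ends of the
arc, the pairs alternate. -/
theorem conflict_of_arcCount_ne_zero {α : ι} {e : Sym2 C.Occ} (he : C.IsConEdgeFor α e)
    {x : C.Occ} {m : ℕ} (hm : m < Function.minimalPeriod C.next x) (hx : x ∉ e)
    (hy : C.next^[m] x ∉ e) (h : arcCount x m e ≠ 0) : C.Conflict e s(x, C.next^[m] x) := by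
  obtain ⟨p, q, rfl, -, -, hs, hpq⟩ := he.exists_eq
  have hxp : C.next.SameCycle x p := by
    by_contra hxp
    apply h
    refine sum_eq_zero fun j _ => if_neg fun hj => ?_
    have hj' : C.next.SameCycle x (C.next^[j + 1] x) :=
      ⟨(j + 1 : ℕ), by rw [zpow_natCast, ← Equiv.Perm.iterate_eq_pow]⟩
    rcases Sym2.mem_iff.1 hj with h1 | h1 <;> rw [h1] at hj'
    exacts [hxp hj', hxp (hj'.trans hs.symm)]
  obtain ⟨i, hin, rfl⟩ := exists_iterate_eq hxp
  obtain ⟨l, hln, rfl⟩ := exists_iterate_eq (hxp.trans hs)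
  have hi : i ≠ 0 := by rintro rfl; exact hx (by simp)
  have hl : l ≠ 0 := by rintro rfl; exact hx (by simp)
  have him : i ≠ m := by rintro rfl; exact hy (by simp)
  have hlm : l ≠ m := by rintro rfl; exact hy (by simp)
  have hil : i ≠ l := by rintro rfl; exact hpq rfl
  rw [arcCount_mk (by omega) hin (by omega) hln hil hm] at h
  apply C.conflict_symm
  by_cases h1 : i ≤ m
  · by_cases h2 : l ≤ m
    · simp [h1, h2, CharTwo.add_self_eq_zero] at h
    · refine ⟨_, _, _, _, rfl, rfl, i, m, l, by omega, by omega, by omega, hln, ?_, ?_, ?_⟩ <;>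
        rw [Equiv.Perm.iterate_eq_pow]
  · by_cases h2 : l ≤ m
    · refine ⟨_, _, _, _, rfl, Sym2.eq_swap, l, m, i, by omega, by omega, by omega, hin,
        ?_, ?_, ?_⟩ <;> rw [Equiv.Perm.iterate_eq_pow]
    · simp [h1, h2] at h

theorem exists_arcCount_eq_one {e e' : Sym2 C.Occ} (h : C.Conflict e' e) :
    ∃ x m, m < Function.minimalPeriod C.next x ∧ e' = s(x, C.next^[m] x) ∧
      arcCount x m e = 1 := by
  obtain ⟨x, y, c, d, rfl, rfl, i, m, l, hi, him, hml, hl, rfl, rfl, rfl⟩ := h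
  simp only [← Equiv.Perm.iterate_eq_pow]
  refine ⟨x, m, by omega, rfl, ?_⟩
  rw [arcCount_mk hi (by omega) (by omega) hl (by omega) (by omega), if_pos (by omega),
    if_neg (by omega), add_zero]

/-- A con-edge outside the cluster `α` that crosses no con-edge of a chain of `α` joins occurrences
of equal potential. -/
theorem IsChain.potential_eq {K : Set (Sym2 C.Occ)} {α β : ι} {u v : V} {g : C.Occ → ZMod 2}
    {k : Sym2 C.Occ → ZMod 2} (h : IsChain K α u v g k) {ψ : C.Occ → ZMod 2}
    (hψ : ∀ d, ψ (C.next d) = ψ d + endCount k (C.next d)) (hαβ : α ≠ β) {a b : C.Occ}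
    (hab : C.IsConEdgeFor β s(a, b)) (hc : ∀ e, k e ≠ 0 → ¬ C.Conflict e s(a, b)) :
    ψ b = ψ a := by
  have hs : C.next.SameCycle a b := by
    obtain ⟨a', b', he, -, -, hs, -⟩ := hab.exists_eq
    rcases Sym2.eq_iff.1 he with ⟨rfl, rfl⟩ | ⟨rfl, rfl⟩
    exacts [hs, hs.symm]
  obtain ⟨m, hm, rfl⟩ := exists_iterate_eq hs
  rw [potential_iterate hψ, sum_eq_zero, add_zero]
  intro e _
  by_cases hk : k e = 0
  · rw [hk, zero_mul]
  have he := (h.conEdge e hk).2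
  -- Clusters are disjoint, so no ends are shared and parity detects crossing.
  have hnot : ∀ d ∈ s(a, C.next^[m] a), d ∉ e := fun d hd hde =>
    hαβ (eq_of_mem_cluster (he.mem_cluster hde) (hab.mem_cluster hd))
  by_contra h0
  exact hc e hk (conflict_of_arcCount_ne_zero he hm (hnot _ (by simp)) (hnot _ (by simp))
    fun h1 => h0 (by rw [h1, mul_zero]))

/-- A closed chain of `α` has a potential that is constant at the vertices outside `α` and along the
edges between them. -/
theorem IsChain.exists_potential {K : Set (Sym2 C.Occ)} {α : ι} {u : V} {g : C.Occ → ZMod 2}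
    {k : Sym2 C.Occ → ZMod 2} (h : IsChain K α u u g k) :
    ∃ (ψ : C.Occ → ZMod 2) (p : V → ZMod 2),
      (∀ d, ψ (C.next d) = ψ d + endCount k (C.next d)) ∧
      (∀ d : C.Occ, d.fst ∉ C.cluster α → ψ d = p d.fst) ∧
      ∀ d : C.Occ, d.fst ∉ C.cluster α → ψ d.symm = ψ d := by
  obtain ⟨ψ, hψg, hψ⟩ := C.embedding.exists_potential g (endCount k) h.symm
    (fun r => h.sum_face r) fun w => by
      rw [h.boundary, CharTwo.add_self_eq_zero]
  have hsymm : ∀ d : C.Occ, d.fst ∉ C.cluster α → ψ d.symm = ψ d := by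
    intro d hd
    have hg : g d = 0 := by
      by_contra h0
      exact hd (h.mem_cluster d h0)
    exact (PlanarEmbedding.zmod_two_eq_of_add_eq_zero ((hψg d).trans hg)).symm
  -- Turning around a vertex outside `α` meets neither an edge nor a con-edge end of the chain.
  have hrot : ∀ d : C.Occ, d.fst ∉ C.cluster α → ψ (C.embedding.rot d) = ψ d := by
    intro d hd
    have h1 := hψ d.symm
    rw [PlanarEmbedding.facePerm_symm, hsymm d hd] at h1
    rw [h1, endCount, sum_eq_zero, add_zero]
    intro e _
    by_cases hk : k e = 0
    · rw [hk, zero_mul]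
    · rw [if_neg, mul_zero]
      intro hde
      have := (h.conEdge e hk).2.mem_cluster hde
      rw [C.embedding.rot_fst] at this
      exact hd this
  have hpow : ∀ (i : ℕ) (d : C.Occ), d.fst ∉ C.cluster α →
      ((C.embedding.rot ^ i) d).fst = d.fst ∧ ψ ((C.embedding.rot ^ i) d) = ψ d := by
    intro i d hd
    induction i with
    | zero => simp
    | succ i ih =>
      rw [pow_succ', Equiv.Perm.mul_apply]
      exact ⟨(C.embedding.rot_fst _).trans ih.1, (hrot _ (ih.1.symm ▸ hd)).trans ih.2⟩
  refine ⟨ψ, fun v => if hv : ∃ d : C.Occ, d.fst = v then ψ hv.choose else 0, hψ,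
    fun d hd => ?_, hsymm⟩
  have hv : ∃ d' : C.Occ, d'.fst = d.fst := ⟨d, rfl⟩
  simp only [dif_pos hv]
  obtain ⟨i, -, hi⟩ := (C.embedding.rot_sameCycle d _ hv.choose_spec.symm).exists_pow_eq'
  rw [← hi, (hpow i d hd).2]

end EmbeddedFlatClusteredGraph

/-! ### The lemma on conflicting con-edges -/

open EmbeddedFlatClusteredGraph in
theorem mainTheorem6 {V ι : Type*} [Finite V] (C : EmbeddedFlatClusteredGraph V ι)
    (A R : Set (Sym2 C.Occ)) (hA : C.IsInstance A R) (hP : C.OnePerComponent A)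
    (eα eβ : Sym2 C.Occ) (hα : eα ∈ A) (hβ : eβ ∈ A) (hconf : C.Conflict eα eβ)
    (S : Set (Sym2 C.Occ)) (hS : C.IsPlanarSpanningTrees A R S) (hnot : eα ∉ S) :
    eβ ∈ S := by
  classical
  have : Fintype V := Fintype.ofFinite V
  by_contra hnotβ
  obtain ⟨hAc, hRc⟩ := hA.subset_conEdges
  have hRA := hA.not_conflict
  have hSR : S ∪ R ⊆ C.conEdges := Set.union_subset (hS.subset.trans hAc) hRc
  obtain ⟨α, hcα⟩ := hAc hα
  obtain ⟨β, hcβ⟩ := hAc hβ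
  have hadj : ∀ e (he : e ∈ A) e' (he' : e' ∈ A), C.Conflict e e' →
      (C.conflictGraph A).Reachable ⟨e, he⟩ ⟨e', he'⟩ :=
    fun e he e' he' h => SimpleGraph.Adj.reachable (G := C.conflictGraph A) h
  have hαβ : α ≠ β := by
    rintro rfl
    have h := congrArg Subtype.val (hP α ⟨eα, hα⟩ ⟨eβ, hβ⟩ hcα hcβ (hadj _ _ _ _ hconf))
    simp only at h
    subst h
    exact C.conflict_irrefl _ hconf
  obtain ⟨a, b, rfl, ha, hb, -, -⟩ := hcα.exists_eq
  obtain ⟨g, k, hgk⟩ := exists_isChain (reflTransGen_joined hSR (hS.tree α) hb ha)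
  -- A con-edge for `α` in `S` crossing `eβ` would be connected to `eα` through `eβ` in the conflict
  -- graph, hence equal to `eα`, which is not in `S`.
  have hmono : ∀ e, k e ≠ 0 → ¬ C.Conflict e eβ := by
    intro e hke hc
    obtain ⟨he | he, hec⟩ := hgk.conEdge e hke
    · have h := congrArg Subtype.val (hP α ⟨e, hS.subset he⟩ ⟨_, hα⟩ hec hcα
        ((hadj e (hS.subset he) _ hβ hc).trans (hadj _ hα _ hβ hconf).symm))
      simp only at h
      exact hnot (h ▸ he)
    · exact hRA e he _ (Or.inl hβ) hc
  have hchain : IsChain (insert s(a, b) (S ∪ R)) α a.fst a.fst _ _ :=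
    (isChain_conEdge (Set.mem_insert _ _) hcα).trans
      ⟨hgk.symm, hgk.mem_cluster, fun e he => ⟨Or.inr (hgk.conEdge e he).1,
        (hgk.conEdge e he).2⟩, hgk.boundary⟩
  obtain ⟨ψ, p, hψ, hp, hsymm⟩ := hchain.exists_potential
  have hout : ∀ v ∈ C.cluster β, v ∉ C.cluster α := fun v h h' => hαβ (eq_of_mem_cluster h' h)
  have hjoin : ∀ u v, Relation.ReflTransGen (C.Joined (S ∪ R) β) u v → p u = p v := by
    intro u v h
    induction h with
    | refl => rfl
    | @tail v w _ hvw ih =>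
      rw [ih]
      obtain ⟨hv, hw, hvw | ⟨c, d, hK, hcd, rfl, rfl⟩⟩ := hvw
      · have h1 := hp ⟨(v, w), hvw⟩ (hout v hv)
        have h2 := hp ⟨(w, v), hvw.symm⟩ (hout w hw)
        rw [← h1, ← h2]
        exact (hsymm ⟨(v, w), hvw⟩ (hout v hv)).symm
      · rw [← hp c (hout _ hv), ← hp d (hout _ hw)]
        refine (hchain.potential_eq hψ hαβ hcd fun e hke hc => ?_).symm
        -- The case `e = eα` uses the assumption `eβ ∉ S`; the others use planarity of `S` or the
        -- freedom of `R` from conflicts.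
        obtain ⟨rfl | heK, hec⟩ := hchain.conEdge e hke
        · rcases hK with hK | hK
          · have h := congrArg Subtype.val (hP β ⟨_, hS.subset hK⟩ ⟨_, hβ⟩ hcd hcβ
              ((hadj _ hα _ (hS.subset hK) hc).symm.trans (hadj _ hα _ hβ hconf)))
            simp only at h
            exact hnotβ (h ▸ hK)
          · exact hRA _ hK _ (Or.inl hα) (C.conflict_symm hc)
        · rcases hK with hK | hK
          · rcases heK with heK | heK
            · exact hS.planar _ heK _ hK hc
            · exact hRA _ heK _ (Or.inl (hS.subset hK)) hc
          · exact hRA _ hK _ (heK.elim (fun h => Or.inl (hS.subset h)) Or.inr)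
              (C.conflict_symm hc)
  obtain ⟨x, m, hm, rfl, hcount⟩ := exists_arcCount_eq_one (C.conflict_symm hconf)
  have hx := hcβ.mem_cluster (Sym2.mem_mk_left _ _)
  have hy := hcβ.mem_cluster (Sym2.mem_mk_right _ _)
  have heq := hjoin _ _ (reflTransGen_joined hSR (hS.tree β) hx hy)
  rw [← hp x (hout _ hx), ← hp _ (hout _ hy), potential_iterate hψ] at heq
  have hzero : ∀ e, k e * arcCount x m e = 0 := by
    intro e
    by_cases hke : k e = 0
    · rw [hke, zero_mul]
    have hec := (hgk.conEdge e hke).2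
    have hne : ∀ d ∈ s(x, C.next^[m] x), d ∉ e := fun d hd hde =>
      hout _ (hcβ.mem_cluster hd) (hec.mem_cluster hde)
    by_contra h0
    exact hmono e hke (conflict_of_arcCount_ne_zero hec hm (hne _ (by simp)) (hne _ (by simp))
      fun h1 => h0 (by rw [h1, mul_zero]))
  -- Only `eα` separates the ends of `eβ`, so the potential changes by 1 between them.
  have hone : ∑ e, (Pi.single s(a, b) (1 : ZMod 2) + k : Sym2 C.Occ → ZMod 2) e *
      arcCount x m e = 1 := by
    simp only [Pi.add_apply, add_mul, hzero, add_zero, Pi.single_apply, ite_mul, one_mul,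
      zero_mul, Finset.sum_ite_eq', Finset.mem_univ, if_true, hcount]
  rw [hone] at heq
  simp at heq
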